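/- **Setting.** Let $K\ge 2$ be the number of arms and, for each arm $k$, let $\Theta_k$ be a set of probability measures on $[0,1]$; put $\Theta=\Theta_1\times\dots\times\Theta_K$. For an environment $\theta=(\nu_1,\dots,\nu_K)\in\Theta$ let $\mu_k=\int x\,d\nu_k(x)$ and $\mu^*=\max_k\mu_k$, and fix an arm $k^*$ with $\mu_{k^*}=\mu^*$. A policy is a sequence $(\sigma_t)_{t\ge1}$, where $\sigma_t$ is a measurable map from $\{1,\dots,K\}^{t-1}\times[0,1]^{t-1}$ (past actions and past rewards) to the set of probabilities on $\{1,\dots,K\}$; it may depend on the number of rounds $n$ if $n$ is known in advance. Under $\mathbb P_\theta$ the rewards $X_{k,1},\dots,X_{k,n}$ of arm $k$ are i.i.d. with law $\nu_k$, and these $K$ sequences are independent. At round $t=1,\dots,n$ the arm $I_t$ is drawn, given the past and the rewards $(X_{k,s})$, from the probability that $\sigma_t$ assigns to the past actions and observed rewards, and the reward $X_{I_t,T_{I_t}(t)}$ is observed, where $T_k(t)=\sum_{s=1}^t\mathbf 1_{\{I_s=k\}}$. The regret is $$R_n=\sum_{t=1}^nX_{k^*,t}-\sum_{t=1}^nX_{I_t,T_{I_t}(t)}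 .$$ For $\alpha\in[0,1]$ the policy is called $\alpha$-consistent if $\mathbb E_\theta[R_n]=o(n^a)$ as $n\to\infty$ for all $a>\alpha$ and all $\theta\in\Theta$. Finally let $$D_k(\theta)=\inf\bigl\{KL(\nu_k,\tilde\nu)\;:\;\tilde\nu\in\Theta_k,\ \textstyle\int x\,d\tilde\nu(x)>\mu^*\bigr\}\in[0,+\infty],$$ where $KL$ is the Kullback–Leibler divergence and $\inf\emptyset=+\infty$. **Theorem.** Let $\alpha\in[0,1]$, fix an $\alpha$-consistent policy and $\theta\in\Theta$. If $k$ is a suboptimal arm (i.e. $\mu_k<\mu^*$) and $0<D_k(\theta)<+\infty$, then $$\forall\varepsilon>0,\qquad \lim_{n\to+\infty}\mathbb P_\theta\left[T_k(n)\ge(1-\varepsilon)\frac{(1-\alpha)\log n}{D_k(\theta)}\right]=1 ,$$ and consequently $$\liminf_{n\to+\infty}\frac{\mathbb E_\theta[T_k(n)]}{\log n}\ \ge\ \frac{1-\alpha}{D_k(\theta)} .$$ -/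

import Mathlib

open MeasureTheory ProbabilityTheory Filter Topology Asymptotics InformationTheory
open scoped ENNReal unitInterval

noncomputable section

namespace Bandit

/-- Reward distributions: probability measures on `[0,1]`. -/
abbrev RewardDist : Type := ProbabilityMeasure I

/-- An environment `θ = (ν_1, …, ν_K)`. -/
abbrev Env (K : ℕ) : Type := Fin K → RewardDist

/-- Mean of a reward distribution. -/
def mean (ν : RewardDist) : ℝ := ∫ x, (x : ℝ) ∂(ν : Measure I)

/-- The best mean `μ^* = max_k μ_k`. -/
def bestMean {K : ℕ} (θ : Env K) : ℝ := ⨆ k, mean (θ k)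

/-- `D_k(θ)`, the infimum of `KL(ν_k, ν̃)` over those `ν̃ ∈ Θ_k` whose mean exceeds `μ^*`
(it is `∞` if there is no such `ν̃`). -/
def infKL {K : ℕ} (Θ : Fin K → Set RewardDist) (θ : Env K) (k : Fin K) : ℝ≥0∞ :=
  ⨅ ν ∈ {ν | ν ∈ Θ k ∧ bestMean θ < mean ν}, klDiv (θ k : Measure I) (ν : Measure I)

/-- A (possibly randomized) policy: for each `t`, a measurable map that sends the `t` past actions
and the `t` past rewards to a probability on the arms, from which the next arm is drawn.
Rounds are numbered from `0`. -/
structure Policy (K : ℕ) where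
  choice : ∀ t : ℕ, Kernel ((Fin t → Fin K) × (Fin t → I)) (Fin K)
  isMarkov : ∀ t, IsMarkovKernel (choice t)

/-- Reward tables for a game of `n` rounds: `x k s` is the reward of the `(s+1)`-st pull of
arm `k`. -/
abbrev Table (K n : ℕ) : Type := Fin K → Fin n → I

/-- Outcomes of a game of `n` rounds: the reward table, and the arms that were played. -/
abbrev Outcome (K n : ℕ) : Type := Table K n × (Fin n → Fin K)

/-- Number of rounds before round `s` at which the arm played at round `s` was already played. -/
def earlierPulls {K t : ℕ} (a : Fin t → Fin K) (s : Fin t) : ℕ :=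
  (Finset.univ.filter fun r : Fin t => r < s ∧ a r = a s).card

theorem earlierPulls_lt {K t : ℕ} (a : Fin t → Fin K) (s : Fin t) : earlierPulls a s < t := by
  refine lt_of_lt_of_eq (Finset.card_lt_univ_of_notMem (x := s) ?_) (Fintype.card_fin t)
  simp

/-- Rewards received in the first `t` rounds if the arms `a` are played: when an arm is played for
the `(j+1)`-st time, entry number `j` (counted from `0`) of its row in the table is received. -/
def rewards {K n t : ℕ} (ht : t ≤ n) (x : Table K n) (a : Fin t → Fin K) (s : Fin t) : I :=
  x (a s) ⟨earlierPulls a s, (earlierPulls_lt a s).trans_le ht⟩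

/-- Conditional probability, given the reward table, that the policy `pol` plays the arms `a`: the
product over the rounds of the probability with which `pol` picks the arm of that round after the
actions and rewards of the earlier rounds. -/
def playProb {K n : ℕ} (pol : Policy K) (ω : Outcome K n) : ℝ≥0∞ :=
  ∏ t : Fin n,
    pol.choice t (Fin.take t t.isLt.le ω.2, rewards t.isLt.le ω.1 (Fin.take t t.isLt.le ω.2)) {ω.2 t}

/-- The law `P_θ` of a game of `n` rounds: the rewards `X_{k,1}, …, X_{k,n}` of each arm `k` are
i.i.d. with law `ν_k`, the rows of the table are independent, and given the table the arms `a` are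
played with probability `playProb`. -/
def law {K : ℕ} (pol : Policy K) (θ : Env K) (n : ℕ) : Measure (Outcome K n) :=
  ((Measure.pi fun k => Measure.pi fun _ : Fin n => (θ k : Measure I)).prod
    Measure.count).withDensity (playProb pol)

/-- `T_k(n)`, the number of pulls of arm `k` during the game. -/
def pulls {K n : ℕ} (k : Fin K) (ω : Outcome K n) : ℕ :=
  (Finset.univ.filter fun t : Fin n => ω.2 t = k).card

/-- The regret `R_n = ∑_t X_{k^*,t} - ∑_t X_{I_t, T_{I_t}(t)}` with respect to the arm `kstar`. -/
def regret {K n : ℕ} (kstar : Fin K) (ω : Outcome K n) : ℝ :=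
  ∑ t : Fin n, (ω.1 kstar t : ℝ) - ∑ t : Fin n, (rewards le_rfl ω.1 ω.2 t : ℝ)

/-- `α`-consistency over `Θ = Θ_1 × ⋯ × Θ_K`: for every environment `θ ∈ Θ`, with a fixed best arm
`kstar`, `E_θ[R_n] = o(n^a)` for all `a > α`. Here `pol n` is the policy used when the number of
rounds is `n`; a constant family is a policy that does not know the number of rounds. -/
def IsConsistent {K : ℕ} (Θ : Fin K → Set RewardDist) (α : ℝ) (pol : ℕ → Policy K) : Prop :=
  ∀ θ : Env K, (∀ k, θ k ∈ Θ k) →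
    ∃ kstar : Fin K, mean (θ kstar) = bestMean θ ∧
      ∀ a : ℝ, α < a →
        (fun n : ℕ => ∫ ω, regret kstar ω ∂(law (pol n) θ n)) =o[atTop] fun n : ℕ => (n : ℝ) ^ a

end Bandit

end

/-! Consistency forces exploration. Replace the law of arm `k` by some `ν ∈ Θ k` with mean above
`μ^*` and finite divergence `κ` from `θ k`. In the new environment `θ'` arm `k` is the unique best
arm, so each round spent elsewhere costs a fixed amount in expectation, and consistency with
Markov's inequality makes `T_k(n) < F` have probability at most of order `n^(a-1)` for every `a > α`
(`IsConsistent.eventually_law_pulls_lt_le`).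

Given the reward table, the probability of `T_k(n) < F` involves row `k` only through its first `F`
entries. Changing measure on all of these entries, revealed or not, therefore costs a likelihood
ratio of a deterministic number of i.i.d. terms (`law_pulls_lt_le`); no stopping time or maximal
inequality enters. By the law of large numbers its logarithm is at most `c * F` with high
probability for any `c > κ`. With `F ≈ β log n` the event has probability at most `o(1) + O(n^(c * β
+ a - 1))` under `θ`, which vanishes for suitable `c` and `a` when `β * κ < 1 - α`. Taking `κ` close
to the infimum gives the probability bound; Markov's inequality turns it into the bound on the
expectation. -/

/-! ### Finite product measures. -/

section ProductMeasures

variable {ι : Type*} [Fintype ι] {X : ι → Type*} [∀ i, MeasurableSpace (X i)]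

open Classical in
/-- Taking the coordinates in `S` from one product measure and the others from another one gives
the product of the corresponding factors. -/
theorem map_merge_pi_prod_pi (μ ν : ∀ i, Measure (X i)) [∀ i, IsProbabilityMeasure (μ i)]
    [∀ i, IsProbabilityMeasure (ν i)] (S : Set ι) :
    MeasurePreserving (fun (p : (∀ i, X i) × (∀ i, X i)) i => if i ∈ S then p.1 i else p.2 i)
      ((Measure.pi μ).prod (Measure.pi ν)) (Measure.pi fun i => if i ∈ S then μ i else ν i) := by
  have hm : Measurable
      (fun (p : (∀ i, X i) × (∀ i, X i)) i => if i ∈ S then p.1 i else p.2 i) := by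
    refine measurable_pi_lambda _ fun i => ?_
    by_cases h : i ∈ S
    · simp only [h, if_true]; fun_prop
    · simp only [h, if_false]; fun_prop
  have : ∀ i, IsProbabilityMeasure (if i ∈ S then μ i else ν i) := fun i => by
    split_ifs <;> infer_instance
  refine ⟨hm, (Measure.pi_eq fun s hs => ?_).symm⟩
  have hpre : (fun (p : (∀ i, X i) × (∀ i, X i)) i => if i ∈ S then p.1 i else p.2 i) ⁻¹'
      (Set.univ.pi s) = (Set.univ.pi fun i => if i ∈ S then s i else Set.univ) ×ˢ
        (Set.univ.pi fun i => if i ∈ S then Set.univ else s i) := by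
    ext p
    simp only [Set.mem_preimage, Set.mem_pi, Set.mem_univ, forall_true_left, Set.mem_prod,
      ← forall_and]
    refine forall_congr' fun i => ?_
    by_cases h : i ∈ S <;> simp [h]
  rw [Measure.map_apply hm (MeasurableSet.univ_pi hs), hpre, Measure.prod_prod, Measure.pi_pi,
    Measure.pi_pi, ← Finset.prod_mul_distrib]
  refine Finset.prod_congr rfl fun i _ => ?_
  by_cases h : i ∈ S <;> simp [h]

/-- The integral of a function of the coordinates in `S` only depends on the factors in `S`. -/
theorem lintegral_pi_congr_of_dependsOn {μ ν : ∀ i, Measure (X i)}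
    [∀ i, IsProbabilityMeasure (μ i)] [∀ i, IsProbabilityMeasure (ν i)] {S : Set ι}
    {f : (∀ i, X i) → ℝ≥0∞} (hf : Measurable f) (hS : DependsOn f S)
    (h : ∀ i ∈ S, μ i = ν i) : ∫⁻ x, f x ∂Measure.pi μ = ∫⁻ x, f x ∂Measure.pi ν := by
  classical
  -- The merged point has law `Measure.pi ν`, because the factors agree on `S`, while `f` sees only
  -- its part drawn from `μ`.
  have key := map_merge_pi_prod_pi μ ν S
  have e : (fun i => if i ∈ S then μ i else ν i) = ν := by
    funext i
    by_cases hi : i ∈ S <;> simp [hi, h]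
  rw [e] at key
  rw [← key.lintegral_comp hf, lintegral_prod _ (Measurable.aemeasurable (by exact hf.comp key.measurable))]
  refine lintegral_congr fun x => ?_
  have : ∀ y : ∀ i, X i, f (fun i => if i ∈ S then x i else y i) = f x := fun y =>
    hS fun i hi => by simp [hi]
  simp [this]

/-- The coordinate `i` of a product measure can be integrated first. -/
theorem lintegral_pi_eq_lintegral_update [DecidableEq ι] (μ : ∀ i, Measure (X i))
    [∀ i, IsProbabilityMeasure (μ i)] (i : ι) {f : (∀ i, X i) → ℝ≥0∞} (hf : Measurable f) :
    ∫⁻ x, f x ∂Measure.pi μ =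
      ∫⁻ x, ∫⁻ y, f (Function.update x i y) ∂μ i ∂Measure.pi μ := by
  -- Resampling coordinate `i` from an independent copy preserves the product law.
  have key := map_merge_pi_prod_pi μ μ {i}ᶜ
  simp only [ite_self] at key
  rw [← key.lintegral_comp hf, lintegral_prod _ (Measurable.aemeasurable (by exact hf.comp key.measurable))]
  refine lintegral_congr fun x => ?_
  have hx : Measurable (fun y => f (Function.update x i y)) :=
    hf.comp (measurable_update x)
  rw [← (measurePreserving_eval μ i).lintegral_comp hx]
  refine lintegral_congr fun y => congrArg f ?_
  funext j
  by_cases hj : j = i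
  · subst hj; simp
  · simp [hj]

/-- A product of measures with densities has the product density. -/
theorem pi_withDensity (μ : ∀ i, Measure (X i)) [∀ i, IsProbabilityMeasure (μ i)]
    {f : ∀ i, X i → ℝ≥0∞} (hf : ∀ i, Measurable (f i))
    [∀ i, SigmaFinite ((μ i).withDensity (f i))] :
    Measure.pi (fun i => (μ i).withDensity (f i)) =
      (Measure.pi μ).withDensity fun x => ∏ i, f i (x i) := by
  classical
  refine Measure.pi_eq fun s hs => ?_
  have hind : iIndepFun (fun i (x : ∀ i, X i) => (s i).indicator (f i) (x i)) (Measure.pi μ) :=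
    iIndepFun_pi (X := fun i => (s i).indicator (f i)) fun i =>
      ((hf i).indicator (hs i)).aemeasurable
  rw [withDensity_apply _ (MeasurableSet.univ_pi hs), ← lintegral_indicator (MeasurableSet.univ_pi hs)]
  have e : ∀ x : ∀ i, X i, (Set.univ.pi s).indicator (fun x => ∏ i, f i (x i)) x =
      ∏ i, (s i).indicator (f i) (x i) := by
    intro x
    by_cases hx : x ∈ Set.univ.pi s
    · rw [Set.indicator_of_mem hx]
      exact Finset.prod_congr rfl fun i _ => (Set.indicator_of_mem (hx i trivial) _).symm
    · rw [Set.indicator_of_notMem hx]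
      simp only [Set.mem_pi, Set.mem_univ, forall_true_left, not_forall] at hx
      obtain ⟨i, hi⟩ := hx
      exact (Finset.prod_eq_zero (Finset.mem_univ i) (Set.indicator_of_notMem hi _)).symm
  rw [lintegral_congr e, lintegral_prod_eq_prod_lintegral_of_indepFun Finset.univ _ hind
    fun i => ((hf i).indicator (hs i)).comp (measurable_pi_apply i)]
  refine Finset.prod_congr rfl fun i _ => ?_
  rw [withDensity_apply _ (hs i), ← lintegral_indicator (hs i),
    ← (measurePreserving_eval μ i).lintegral_comp ((hf i).indicator (hs i))]

end ProductMeasures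

/-! ### Change of measure. -/

/-- Change of measure for functions of finitely many independent coordinates: outside of the event
that the log-likelihood ratio exceeds `c`, the factor is at most `exp c`. -/
theorem lintegral_pi_le_add_exp_mul_lintegral_pi {ι X : Type*} [Fintype ι] [MeasurableSpace X]
    {μ ν : Measure X} [IsProbabilityMeasure μ] [IsProbabilityMeasure ν] (hμν : μ ≪ ν)
    (S : Finset ι) {f : (ι → X) → ℝ≥0∞} (hf : Measurable f) (hf1 : ∀ x, f x ≤ 1)
    (hS : DependsOn f (S : Set ι)) (c : ℝ) :
    ∫⁻ x, f x ∂Measure.pi (fun _ => μ) ≤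
      Measure.pi (fun _ => μ) {x : ι → X | c < ∑ i ∈ S, llr μ ν (x i)} +
        ENNReal.ofReal (Real.exp c) * ∫⁻ x, f x ∂Measure.pi (fun _ => ν) := by
  classical
  set E : Set (ι → X) := {x | c < ∑ i ∈ S, llr μ ν (x i)} with hE
  have hmE : MeasurableSet E := measurableSet_lt measurable_const
    (Finset.measurable_sum _ fun i _ => (measurable_llr μ ν).comp (measurable_pi_apply i))
  -- A finite version of the density, in the form whose logarithm is `llr`.
  set d : X → ℝ≥0∞ := fun x => ENNReal.ofReal (μ.rnDeriv ν x).toReal with hd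
  have hmd : Measurable d := (Measure.measurable_rnDeriv μ ν).ennreal_toReal.ennreal_ofReal
  have hμd : ν.withDensity d = μ := by
    refine Eq.trans (withDensity_congr_ae ?_) (Measure.withDensity_rnDeriv_eq μ ν hμν)
    filter_upwards [Measure.rnDeriv_lt_top μ ν] with x hx
    exact ENNReal.ofReal_toReal hx.ne
  -- Only the coordinates in `S` are tilted: the others are invisible to `f`, and tilting them would
  -- bring extra likelihood factors.
  set D : ι → X → ℝ≥0∞ := fun i => if i ∈ S then d else 1 with hD
  have hmD : ∀ i, Measurable (D i) := fun i => by
    by_cases h : i ∈ S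
    · simpa [hD, h] using hmd
    · simp only [hD, h, if_false]; exact measurable_const
  have hνD : (fun i => ν.withDensity (D i)) = fun i => if i ∈ S then μ else ν := by
    funext i
    by_cases h : i ∈ S <;> simp [hD, h, hμd]
  have hprob : ∀ i, IsProbabilityMeasure (ν.withDensity (D i)) := fun i => by
    rw [congrFun hνD i]
    split_ifs <;> infer_instance
  have hmg : Measurable (Eᶜ.indicator f) := hf.indicator hmE.compl
  have hgS : DependsOn (Eᶜ.indicator f) (S : Set ι) := by
    intro x y hxy
    have h1 : f x = f y := hS hxy
    have h2 : x ∈ E ↔ y ∈ E := by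
      simp only [hE, Set.mem_ofPred_eq]
      rw [Finset.sum_congr rfl fun i hi => by rw [hxy i hi]]
    by_cases h : x ∈ E
    · simp [Set.indicator, h, h2.1 h]
    · simp [Set.indicator, h, mt h2.2 h, h1]
  calc ∫⁻ x, f x ∂Measure.pi (fun _ => μ)
      ≤ ∫⁻ x, (E.indicator 1 x + Eᶜ.indicator f x) ∂Measure.pi (fun _ => μ) := by
        refine lintegral_mono fun x => ?_
        by_cases h : x ∈ E <;> simp [h, hf1]
    _ = Measure.pi (fun _ => μ) E + ∫⁻ x, Eᶜ.indicator f x ∂Measure.pi (fun _ => μ) := by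
        rw [lintegral_add_right _ hmg, lintegral_indicator_one hmE]
    _ ≤ _ := by
        gcongr
        rw [lintegral_pi_congr_of_dependsOn (ν := fun i => ν.withDensity (D i)) hmg hgS
          (fun i hi => by rw [congrFun hνD i, if_pos (by exact_mod_cast hi)]),
          pi_withDensity (fun _ => ν) hmD,
          lintegral_withDensity_eq_lintegral_mul _ (by fun_prop) hmg,
          ← lintegral_const_mul _ hf]
        refine lintegral_mono fun x => ?_
        simp only [Pi.mul_apply]
        by_cases h : x ∈ E
        · simp [h]
        rw [Set.indicator_of_mem (by simpa using h)]
        gcongr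
        have hp : ∏ i, D i (x i) = ∏ i ∈ S, d (x i) := by
          rw [← Finset.prod_subset (Finset.subset_univ S)]
          · exact Finset.prod_congr rfl fun i hi => by simp [hD, hi]
          · intro i _ hi; simp [hD, hi]
        rw [hp]
        -- Only an inequality: where the density vanishes, `Real.log 0 = 0` makes the right-hand
        -- factor `1`.
        calc ∏ i ∈ S, d (x i) ≤ ∏ i ∈ S, ENNReal.ofReal (Real.exp (llr μ ν (x i))) := by
              refine Finset.prod_le_prod' fun i _ => ENNReal.ofReal_le_ofReal ?_
              exact Real.le_exp_log _
          _ = ENNReal.ofReal (Real.exp (∑ i ∈ S, llr μ ν (x i))) := by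
              rw [Real.exp_sum, ENNReal.ofReal_prod_of_nonneg fun i _ => (Real.exp_pos _).le]
          _ ≤ _ := ENNReal.ofReal_le_ofReal (Real.exp_le_exp.2 (not_lt.1 h))

/-! ### Law of large numbers. -/

/-- Realizes the product spaces for all `n` on one infinite product, where a limit theorem can be
applied once. -/
theorem map_infinitePi_fin {X : Type*} [MeasurableSpace X] (μ : Measure X)
    [IsProbabilityMeasure μ] (n : ℕ) :
    MeasurePreserving (fun (x : ℕ → X) (i : Fin n) => x i) (Measure.infinitePi fun _ => μ)
      (Measure.pi fun _ => μ) := by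
  have hm : Measurable (fun (x : ℕ → X) (i : Fin n) => x i) := by fun_prop
  refine ⟨hm, (Measure.pi_eq fun s hs => ?_).symm⟩
  have hpre : (fun (x : ℕ → X) (i : Fin n) => x i) ⁻¹' (Set.univ.pi s) =
      Set.pi (Finset.range n) fun i => if h : i < n then s ⟨i, h⟩ else Set.univ := by
    ext x
    simp only [Set.mem_preimage, Set.mem_pi, Set.mem_univ, forall_true_left, Finset.coe_range,
      Set.mem_Iio]
    constructor
    · intro h i hi; simpa [hi] using h ⟨i, hi⟩
    · intro h i; simpa using h i i.2
  rw [Measure.map_apply hm (MeasurableSet.univ_pi hs), hpre, Measure.infinitePi_pi]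
  · rw [Finset.prod_range]
    exact Finset.prod_congr rfl fun i _ => by simp
  · intro i hi
    rw [Finset.mem_range] at hi
    simpa [hi] using hs _

/-- Weak law of large numbers in an infinite product space. -/
theorem tendstoInMeasure_infinitePi_average {X : Type*} [MeasurableSpace X] (μ : Measure X)
    [IsProbabilityMeasure μ] {g : X → ℝ} (hg : Measurable g) (hint : Integrable g μ) :
    TendstoInMeasure (Measure.infinitePi fun _ : ℕ => μ)
      (fun (n : ℕ) (x : ℕ → X) => (n : ℝ)⁻¹ • ∑ i ∈ Finset.range n, g (x i)) atTop
      (fun _ => ∫ x, g x ∂μ) := by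
  have hev : ∀ i, MeasurePreserving (fun x : ℕ → X => x i) (Measure.infinitePi fun _ => μ) μ :=
    fun i => measurePreserving_eval_infinitePi (fun _ => μ) i
  have hgi : ∀ i, Measurable fun x : ℕ → X => g (x i) := fun i => by fun_prop
  have hmap : ∀ j, (Measure.infinitePi fun _ => μ).map (fun x : ℕ → X => g (x j)) = μ.map g :=
    fun j => by
      conv_rhs => rw [← (hev j).map_eq]
      exact (Measure.map_map hg (measurable_pi_apply j)).symm
  have hmean : ∫ x : ℕ → X, g (x 0) ∂(Measure.infinitePi fun _ => μ) = ∫ x, g x ∂μ := by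
    conv_rhs => rw [← (hev 0).map_eq]
    exact (integral_map (hev 0).measurable.aemeasurable hg.aestronglyMeasurable).symm
  have hind : iIndepFun (fun (i : ℕ) (x : ℕ → X) => g (x i)) (Measure.infinitePi fun _ => μ) :=
    iIndepFun_infinitePi (X := fun _ => g) fun _ => hg
  have hslln := strong_law_ae (μ := Measure.infinitePi fun _ => μ)
    (fun (i : ℕ) (x : ℕ → X) => g (x i)) ((hev 0).integrable_comp_of_integrable hint)
    (fun i j hij => hind.indepFun hij)
    fun i => ⟨(hgi i).aemeasurable, (hgi 0).aemeasurable, by rw [hmap, hmap]⟩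
  rw [hmean] at hslln
  refine tendstoInMeasure_of_tendsto_ae (fun n => Measurable.aestronglyMeasurable ?_) hslln
  fun_prop

/-- Weak law of large numbers, as an upper deviation bound for sums over the first `F n` of `n`
independent coordinates. -/
theorem tendsto_pi_sum_gt_zero {X : Type*} [MeasurableSpace X] (μ : Measure X)
    [IsProbabilityMeasure μ] {g : X → ℝ} (hg : Measurable g) (hint : Integrable g μ)
    {c : ℝ} (hc : ∫ x, g x ∂μ < c) {F : ℕ → ℕ} (hF : Tendsto F atTop atTop)
    (hFn : ∀ᶠ n in atTop, F n ≤ n) :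
    Tendsto (fun n => Measure.pi (fun _ => μ) {x : Fin n → X |
        F n * c < ∑ i ∈ Finset.univ.filter (fun i : Fin n => (i : ℕ) < F n), g (x i)})
      atTop (𝓝 0) := by
  have hinm := tendstoInMeasure_infinitePi_average μ hg hint
  rw [tendstoInMeasure_iff_dist] at hinm
  have h0 := (hinm (c - ∫ x, g x ∂μ) (by linarith)).comp hF
  refine tendsto_of_tendsto_of_tendsto_of_le_of_le' tendsto_const_nhds h0
    (Eventually.of_forall fun _ => zero_le) ?_
  filter_upwards [hFn, hF.eventually_gt_atTop 0] with n hn hn0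
  have hsum : ∀ x : ℕ → X, ∑ i ∈ Finset.univ.filter (fun i : Fin n => (i : ℕ) < F n), g (x i) =
      ∑ i ∈ Finset.range (F n), g (x i) := by
    intro x
    rw [Finset.sum_filter, ← Finset.sum_range (fun i => if i < F n then g (x i) else 0),
      ← Finset.sum_filter]
    refine Finset.sum_congr ?_ fun _ _ => rfl
    ext i
    simp only [Finset.mem_filter, Finset.mem_range]
    omega
  rw [← (map_infinitePi_fin μ n).measure_preimage (measurableSet_lt measurable_const
    (by fun_prop)).nullMeasurableSet]
  refine measure_mono fun x hx => ?_
  simp only [Set.mem_preimage, Set.mem_ofPred_eq, hsum x] at hx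
  simp only [Set.mem_ofPred_eq, smul_eq_mul, Real.dist_eq]
  refine le_trans ?_ (le_abs_self _)
  have hpos : (0 : ℝ) < F n := by exact_mod_cast hn0
  have : c ≤ (F n : ℝ)⁻¹ * ∑ i ∈ Finset.range (F n), g (x i) := by
    rw [inv_mul_eq_div, le_div_iff₀ hpos, mul_comm]
    exact hx.le
  linarith

/-! ### Which table entries a play of the game reads. -/

namespace Bandit

variable {K n t : ℕ}

/-- Number of rounds at which the arm `j` is played. -/
def count (a : Fin t → Fin K) (j : Fin K) : ℕ := (Finset.univ.filter fun s => a s = j).card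

theorem count_le (a : Fin t → Fin K) (j : Fin K) : count a j ≤ t :=
  (Finset.card_filter_le _ _).trans_eq (by simp)

theorem earlierPulls_lt_count (a : Fin t → Fin K) (s : Fin t) :
    earlierPulls a s < count a (a s) := by
  refine Finset.card_lt_card (Finset.ssubset_iff_of_subset ?_ |>.2 ⟨s, ?_, ?_⟩)
  · intro r hr
    simp only [Finset.mem_filter] at hr ⊢
    exact ⟨hr.1, hr.2.2⟩
  · simp
  · simp

theorem count_take_le (a : Fin t → Fin K) {s : ℕ} (hs : s ≤ t) (j : Fin K) :
    count (Fin.take s hs a) j ≤ count a j := by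
  refine Finset.card_le_card_of_injOn (Fin.castLE hs) (fun r hr => ?_)
    (Fin.castLE_injective hs).injOn
  simpa [Fin.take_apply] using Finset.mem_filter.1 hr

theorem earlierPulls_snoc_castSucc (a : Fin t → Fin K) (j : Fin K) (s : Fin t) :
    earlierPulls (Fin.snoc (α := fun _ => Fin K) a j) s.castSucc = earlierPulls a s := by
  symm
  refine Finset.card_bij (fun r _ => r.castSucc) ?_ ?_ ?_
  · intro r hr; simpa using hr
  · intro r _ r' _ h; exact Fin.castSucc_injective _ h
  · intro r hr
    simp only [Finset.mem_filter, Finset.mem_univ, true_and, Fin.snoc_castSucc] at hr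
    have hlt : (r : ℕ) < t := lt_trans (Fin.lt_def.1 hr.1) (by simp)
    obtain ⟨r', rfl⟩ : ∃ r' : Fin t, r'.castSucc = r := ⟨⟨r, hlt⟩, rfl⟩
    exact ⟨r', by simpa using hr, rfl⟩

/-- With entries counted from `0`, the new pull of `j` reads entry number `count a j`, the first one
of its row not yet revealed. -/
theorem earlierPulls_snoc_last (a : Fin t → Fin K) (j : Fin K) :
    earlierPulls (Fin.snoc (α := fun _ => Fin K) a j) (Fin.last t) = count a j := by
  symm
  refine Finset.card_bij (fun r _ => r.castSucc) ?_ ?_ ?_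
  · intro r hr; simpa [Fin.castSucc_lt_last] using hr
  · intro r _ r' _ h; exact Fin.castSucc_injective _ h
  · intro r hr
    simp only [Finset.mem_filter, Finset.mem_univ, true_and, Fin.snoc_last] at hr
    obtain ⟨r', rfl⟩ : ∃ r' : Fin t, r'.castSucc = r := ⟨⟨r, Fin.lt_def.1 hr.1⟩, rfl⟩
    exact ⟨r', by simpa using hr.2, rfl⟩

theorem rewards_snoc_castSucc (ht : t + 1 ≤ n) (x : Table K n) (a : Fin t → Fin K) (j : Fin K)
    (s : Fin t) : rewards ht x (Fin.snoc (α := fun _ => Fin K) a j) s.castSucc =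
      rewards (Nat.le_of_succ_le ht) x a s := by
  simp only [rewards, earlierPulls_snoc_castSucc, Fin.snoc_castSucc]

theorem rewards_snoc_last (ht : t + 1 ≤ n) (x : Table K n) (a : Fin t → Fin K) (j : Fin K) :
    rewards ht x (Fin.snoc (α := fun _ => Fin K) a j) (Fin.last t) =
      x j ⟨count a j, (count_le a j).trans_lt ht⟩ := by
  simp only [rewards, earlierPulls_snoc_last, Fin.snoc_last]

/-- The rewards only depend on the entries of the table that are revealed. -/
theorem rewards_congr (ht : t ≤ n) {x y : Table K n} (a : Fin t → Fin K)
    (h : ∀ j (m : Fin n), (m : ℕ) < count a j → x j m = y j m) :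
    rewards ht x a = rewards ht y a :=
  funext fun s => h _ _ (earlierPulls_lt_count a s)

theorem measurable_rewards (ht : t ≤ n) (a : Fin t → Fin K) :
    Measurable fun x : Table K n => rewards ht x a := by
  unfold rewards
  fun_prop

/-- Conditional probability, given the reward table, that the first `t` actions are `a`. -/
noncomputable def prefixProb (pol : Policy K) (ht : t ≤ n) (x : Table K n) (a : Fin t → Fin K) : ℝ≥0∞ :=
  ∏ s : Fin t, pol.choice s (Fin.take s s.isLt.le a,
    rewards (s.isLt.le.trans ht) x (Fin.take s s.isLt.le a)) {a s}

theorem prefixProb_snoc (pol : Policy K) (ht : t + 1 ≤ n) (x : Table K n) (a : Fin t → Fin K)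
    (j : Fin K) : prefixProb pol ht x (Fin.snoc (α := fun _ => Fin K) a j) =
      prefixProb pol (Nat.le_of_succ_le ht) x a *
        pol.choice t (a, rewards (Nat.le_of_succ_le ht) x a) {j} := by
  have htake : ∀ (s : ℕ) (hs : s ≤ t), Fin.take s (Nat.le_succ_of_le hs)
      (Fin.snoc (α := fun _ => Fin K) a j) = Fin.take s hs a := by
    intro s hs
    funext r
    exact Fin.snoc_castSucc (α := fun _ => Fin K) j a (Fin.castLE hs r)
  rw [prefixProb, Fin.prod_univ_castSucc]
  congr 1
  · refine Finset.prod_congr rfl fun s _ => ?_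
    have := htake s s.isLt.le
    simp only [Fin.val_castSucc, this, Fin.snoc_castSucc]
  · have := htake t le_rfl
    simp only [Fin.val_last, this, Fin.take_eq_self, Fin.snoc_last]

/-- Each choice sees only rewards already received, and these occupy the first `count a j` entries
of row `j`. This yields both the independence of the next reward from the past and the locality
behind the change of measure. -/
theorem prefixProb_congr (pol : Policy K) (ht : t ≤ n) {x y : Table K n} (a : Fin t → Fin K)
    (h : ∀ j (m : Fin n), (m : ℕ) < count a j → x j m = y j m) :
    prefixProb pol ht x a = prefixProb pol ht y a := by
  refine Finset.prod_congr rfl fun s _ => ?_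
  rw [rewards_congr _ (Fin.take s s.isLt.le a) fun j m hm =>
    h j m (hm.trans_le (count_take_le a s.isLt.le j))]

theorem measurable_prefixProb (pol : Policy K) (ht : t ≤ n) (a : Fin t → Fin K) :
    Measurable fun x : Table K n => prefixProb pol ht x a := by
  refine Finset.measurable_prod _ fun s _ => ?_
  exact ((pol.choice s).measurable_coe (measurableSet_singleton _)).comp
    (measurable_const.prodMk (measurable_rewards _ _))

theorem sum_prefixProb_succ (pol : Policy K) (ht : t + 1 ≤ n) (x : Table K n)
    (f : (Fin (t + 1) → Fin K) → ℝ≥0∞) :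
    ∑ a, prefixProb pol ht x a * f a =
      ∑ a, ∑ j, prefixProb pol ht x (Fin.snoc (α := fun _ => Fin K) a j) *
        f (Fin.snoc (α := fun _ => Fin K) a j) := by
  rw [← (Fin.snocEquiv fun _ => Fin K).sum_comp, Fintype.sum_prod_type, Finset.sum_comm]
  rfl

theorem sum_prefixProb_snoc (pol : Policy K) (ht : t + 1 ≤ n) (x : Table K n)
    (a : Fin t → Fin K) :
    ∑ j, prefixProb pol ht x (Fin.snoc (α := fun _ => Fin K) a j) =
      prefixProb pol (Nat.le_of_succ_le ht) x a := by
  have := pol.isMarkov t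
  simp_rw [prefixProb_snoc, ← Finset.mul_sum]
  rw [sum_measure_singleton, Finset.coe_univ, measure_univ, mul_one]

theorem sum_prefixProb (pol : Policy K) (ht : t ≤ n) (x : Table K n) :
    ∑ a, prefixProb pol ht x a = 1 := by
  induction t with
  | zero => simp [prefixProb]
  | succ t ih =>
    have h := sum_prefixProb_succ pol ht x fun _ => 1
    simp only [mul_one, sum_prefixProb_snoc, ih] at h
    exact h

/-! ### The law of the game and expected rewards. -/

/-- The law of the reward table. -/
noncomputable abbrev tableLaw (θ : Env K) (n : ℕ) : Measure (Table K n) :=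
  Measure.pi fun k => Measure.pi fun _ : Fin n => (θ k : Measure I)

theorem measurable_playProb (pol : Policy K) : Measurable (playProb (n := n) pol) :=
  measurable_from_prod_countable_left fun a => measurable_prefixProb pol le_rfl a

theorem lintegral_law (pol : Policy K) (θ : Env K) {f : Outcome K n → ℝ≥0∞}
    (hf : Measurable f) : ∫⁻ ω, f ω ∂law pol θ n =
      ∫⁻ x, ∑ a, prefixProb pol le_rfl x a * f (x, a) ∂tableLaw θ n := by
  rw [law, lintegral_withDensity_eq_lintegral_mul _ (measurable_playProb pol) hf,
    lintegral_prod _ ((measurable_playProb pol).mul hf).aemeasurable]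
  refine lintegral_congr fun x => ?_
  rw [lintegral_count, tsum_fintype]
  rfl

instance (pol : Policy K) (θ : Env K) : IsProbabilityMeasure (law pol θ n) :=
  ⟨by rw [← lintegral_one, lintegral_law pol θ measurable_const]; simp [sum_prefixProb]⟩

/-- Independence of one entry from everything else in the table: resample row `j`, then its entry
`m`. -/
theorem lintegral_tableLaw_mul_entry (θ : Env K) {f : Table K n → ℝ≥0∞} (hf : Measurable f)
    {g : I → ℝ≥0∞} (hg : Measurable g) (j : Fin K) (m : Fin n)
    (hfd : ∀ x y, (∀ i s, ¬(i = j ∧ s = m) → x i s = y i s) → f x = f y) :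
    ∫⁻ x, f x * g (x j m) ∂tableLaw θ n =
      (∫⁻ x, f x ∂tableLaw θ n) * ∫⁻ z, g z ∂(θ j : Measure I) := by
  have hfg : Measurable fun x : Table K n => f x * g (x j m) := by fun_prop
  rw [lintegral_pi_eq_lintegral_update _ j hfg, lintegral_pi_eq_lintegral_update _ j hf,
    ← lintegral_mul_const]
  · refine lintegral_congr fun x => ?_
    have hu : Measurable fun r => f (Function.update x j r) := hf.comp (measurable_update x)
    simp only [Function.update_self]
    rw [lintegral_pi_eq_lintegral_update _ m (by fun_prop), ← lintegral_mul_const _ hu]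
    refine lintegral_congr fun r => ?_
    have : ∀ z, f (Function.update x j (Function.update r m z)) = f (Function.update x j r) := by
      refine fun z => hfd _ _ fun i s his => ?_
      by_cases hi : i = j
      · subst hi
        have hs : s ≠ m := fun hs => his ⟨rfl, hs⟩
        simp [hs]
      · simp [hi]
    simp only [this, Function.update_self]
    rw [lintegral_const_mul _ hg]
  · have h1 : Measurable fun p : Table K n × (Fin n → I) => Function.update p.1 j p.2 := by
      refine measurable_pi_lambda _ fun i => ?_
      by_cases hi : i = j
      · subst hi; simpa using measurable_snd
      · simp only [Function.update_of_ne hi]; fun_prop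
    exact (hf.comp h1).lintegral_prod_right'

theorem ofReal_mean (ν : RewardDist) :
    ENNReal.ofReal (mean ν) = ∫⁻ z, ENNReal.ofReal (z : ℝ) ∂(ν : Measure I) := by
  rw [mean, ofReal_integral_eq_lintegral_ofReal]
  · exact Integrable.of_bound (by fun_prop) 1
      (Eventually.of_forall fun z => by simpa [abs_of_nonneg z.2.1] using z.2.2)
  · exact Eventually.of_forall fun z => z.2.1

/-- The expected sum of the rewards is the expected sum of the means of the arms played. -/
theorem lintegral_sum_rewards (pol : Policy K) (θ : Env K) (ht : t ≤ n) :
    ∫⁻ x, ∑ a, prefixProb pol ht x a * ∑ s, ENNReal.ofReal (rewards ht x a s : ℝ)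
        ∂tableLaw θ n =
      ∫⁻ x, ∑ a, prefixProb pol ht x a * ∑ s, ENNReal.ofReal (mean (θ (a s)))
        ∂tableLaw θ n := by
  induction t with
  | zero => simp
  | succ t ih =>
    have hP : ∀ a, Measurable fun x => prefixProb pol ht x a := measurable_prefixProb pol ht
    have hP' := measurable_prefixProb pol (Nat.le_of_succ_le ht)
    have hR := measurable_rewards (K := K) (Nat.le_of_succ_le ht)
    have hR' : ∀ a s, Measurable fun x => rewards (Nat.le_of_succ_le ht) x a s :=
      fun a s => (measurable_pi_apply s).comp (hR a)
    simp_rw [sum_prefixProb_succ, Fin.sum_univ_castSucc, rewards_snoc_castSucc, rewards_snoc_last,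
      Fin.snoc_castSucc, Fin.snoc_last, mul_add, Finset.sum_add_distrib, ← Finset.sum_mul,
      sum_prefixProb_snoc]
    rw [lintegral_add_left (by fun_prop), lintegral_add_left (by fun_prop), ih]
    congr 1
    rw [lintegral_finsetSum _ (fun a _ => by fun_prop), lintegral_finsetSum _ (fun a _ => by fun_prop)]
    refine Finset.sum_congr rfl fun a _ => ?_
    rw [lintegral_finsetSum _ (fun a _ => by fun_prop), lintegral_finsetSum _ (fun a _ => by fun_prop)]
    refine Finset.sum_congr rfl fun j _ => ?_
    rw [lintegral_mul_const _ (hP _), ofReal_mean]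
    refine lintegral_tableLaw_mul_entry θ (hP _) (g := fun z => ENNReal.ofReal (z : ℝ))
      (by fun_prop) j _ fun x y hxy => ?_
    -- The entry paid in the new round has index `count a j`, and the prefix reads row `j` strictly
    -- below it.
    have hc : ∀ i (m : Fin n), (m : ℕ) < count a i → x i m = y i m := by
      intro i m hm
      refine hxy i m ?_
      rintro ⟨rfl, rfl⟩
      exact lt_irrefl _ hm
    rw [prefixProb_snoc, prefixProb_snoc, prefixProb_congr _ _ _ hc, rewards_congr _ _ hc]

end Bandit

/-! ### Transportation of events and lower bounds on regret. -/

namespace Bandit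

variable {K n : ℕ}

theorem mean_nonneg (ν : RewardDist) : 0 ≤ mean ν := integral_nonneg fun z => z.2.1

theorem mean_le_bestMean (θ : Env K) (j : Fin K) : mean (θ j) ≤ bestMean θ :=
  le_ciSup (Set.finite_range fun k => mean (θ k)).bddAbove j

theorem measurable_pulls (k : Fin K) : Measurable (pulls (n := n) k) :=
  (measurable_of_countable fun a : Fin n → Fin K => count a k).comp measurable_snd

theorem pulls_le (k : Fin K) (ω : Outcome K n) : pulls k ω ≤ n := count_le ω.2 k

theorem measurableSet_pulls_lt (k : Fin K) (F : ℕ) :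
    MeasurableSet {ω : Outcome K n | pulls k ω < F} :=
  measurableSet_lt (measurable_pulls k) measurable_const

/-- Transportation of the event that the arm `k` is played less than `F` times: only the first `F`
rewards of the arm `k` matter. -/
theorem law_pulls_lt_le (pol : Policy K) (θ : Env K) (k : Fin K) (ν : RewardDist)
    (hac : (θ k : Measure I) ≪ (ν : Measure I)) (F : ℕ) (c : ℝ) :
    law pol θ n {ω | pulls k ω < F} ≤
      Measure.pi (fun _ => (θ k : Measure I)) {r : Fin n → I |
        c < ∑ i ∈ Finset.univ.filter (fun i : Fin n => (i : ℕ) < F),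
          llr (θ k : Measure I) (ν : Measure I) (r i)} +
      ENNReal.ofReal (Real.exp c) *
        law pol (Function.update θ k ν) n {ω | pulls k ω < F} := by
  classical
  -- Conditional probability of the event given the reward table; it does not involve the
  -- environment.
  set G : Table K n → ℝ≥0∞ := fun x =>
    ∑ a, prefixProb pol le_rfl x a * if count a k < F then 1 else 0 with hG
  have hmP := measurable_prefixProb (n := n) pol le_rfl
  have hmG : Measurable G := by fun_prop
  have hlaw : ∀ θ : Env K, law pol θ n {ω | pulls k ω < F} = ∫⁻ x, G x ∂tableLaw θ n := by
    intro θ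
    rw [← lintegral_indicator_one (measurableSet_pulls_lt k F),
      lintegral_law pol θ (measurable_one.indicator (measurableSet_pulls_lt k F))]
    refine lintegral_congr fun x => Finset.sum_congr rfl fun a _ => ?_
    rw [Set.indicator_apply]
    rfl
  have hG1 : ∀ x, G x ≤ 1 := fun x => by
    rw [← sum_prefixProb pol le_rfl x]
    refine Finset.sum_le_sum fun a _ => ?_
    split_ifs <;> simp
  have hupd : Measurable fun p : Table K n × (Fin n → I) => Function.update p.1 k p.2 := by
    refine measurable_pi_lambda _ fun i => ?_
    by_cases hi : i = k
    · subst hi; simpa using measurable_snd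
    · simp only [Function.update_of_ne hi]; fun_prop
  have hdep : ∀ x : Table K n, DependsOn (fun r => G (Function.update x k r))
      ((Finset.univ.filter fun i : Fin n => (i : ℕ) < F : Finset (Fin n)) : Set (Fin n)) := by
    intro x r r' hr
    refine Finset.sum_congr rfl fun a _ => ?_
    -- An action sequence that contributes has fewer than `F` pulls of `k`, so its probability
    -- ignores row `k` from index `F` on.
    by_cases ha : count a k < F
    · rw [prefixProb_congr pol le_rfl a fun j m hm => ?_]
      by_cases hj : j = k
      · subst hj
        simpa using hr m (by simpa using hm.trans ha)
      · simp [hj]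
    · simp [ha]
  -- Row `k` is integrated against `ν`, so the factor `k` of the outer table law has become
  -- irrelevant and may be replaced by that of the new environment.
  set H : Table K n → ℝ≥0∞ := fun x =>
    ∫⁻ r, G (Function.update x k r) ∂Measure.pi fun _ : Fin n => (ν : Measure I) with hH
  have hmH : Measurable H := (hmG.comp hupd).lintegral_prod_right'
  have hHdep : DependsOn H {k}ᶜ := by
    intro x y hxy
    refine lintegral_congr fun r => congrArg G ?_
    funext j
    by_cases hj : j = k
    · subst hj; simp
    · simpa [hj] using hxy j hj
  have hH' : ∫⁻ x, H x ∂tableLaw θ n = ∫⁻ x, G x ∂tableLaw (Function.update θ k ν) n := by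
    rw [lintegral_pi_eq_lintegral_update _ k hmG]
    simp only [Function.update_self]
    refine lintegral_pi_congr_of_dependsOn hmH hHdep fun j hj => ?_
    rw [Function.update_of_ne hj]
  rw [hlaw, hlaw, lintegral_pi_eq_lintegral_update _ k hmG]
  calc ∫⁻ x, ∫⁻ r, G (Function.update x k r) ∂(Measure.pi fun _ : Fin n => (θ k : Measure I))
        ∂tableLaw θ n
      ≤ ∫⁻ x, (Measure.pi (fun _ => (θ k : Measure I)) {r : Fin n → I |
          c < ∑ i ∈ Finset.univ.filter (fun i : Fin n => (i : ℕ) < F),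
            llr (θ k : Measure I) (ν : Measure I) (r i)} +
          ENNReal.ofReal (Real.exp c) * H x) ∂tableLaw θ n :=
        lintegral_mono fun x => lintegral_pi_le_add_exp_mul_lintegral_pi hac _
          (hmG.comp (measurable_update x)) (fun r => hG1 _) (hdep x) c
    _ = _ := by
        rw [lintegral_add_left measurable_const, lintegral_const_mul _ hmH, hH']
        simp

theorem integrable_law_of_bound (pol : Policy K) (θ : Env K) {f : Outcome K n → ℝ}
    (hf : Measurable f) {C : ℝ} (h0 : ∀ ω, 0 ≤ f ω) (hC : ∀ ω, f ω ≤ C) :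
    Integrable f (law pol θ n) :=
  Integrable.of_bound hf.aestronglyMeasurable C
    (Eventually.of_forall fun ω => by rw [Real.norm_of_nonneg (h0 ω)]; exact hC ω)

theorem integrable_pulls (pol : Policy K) (θ : Env K) (k : Fin K) :
    Integrable (fun ω : Outcome K n => (pulls k ω : ℝ)) (law pol θ n) :=
  integrable_law_of_bound pol θ (measurable_from_top.comp (measurable_pulls k))
    (fun _ => Nat.cast_nonneg _) (fun ω => Nat.cast_le.2 (pulls_le k ω))

theorem integral_law_eq_toReal (pol : Policy K) (θ : Env K) {f : Outcome K n → ℝ}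
    (hf : Measurable f) (h0 : ∀ ω, 0 ≤ f ω) :
    ∫ ω, f ω ∂law pol θ n =
      (∫⁻ x, ∑ a, prefixProb pol le_rfl x a * ENNReal.ofReal (f (x, a)) ∂tableLaw θ n).toReal := by
  rw [integral_eq_lintegral_of_nonneg_ae (Eventually.of_forall h0) hf.aestronglyMeasurable,
    lintegral_law pol θ hf.ennreal_ofReal]

theorem measurable_sum_rewards :
    Measurable fun ω : Outcome K n => ∑ t, (rewards le_rfl ω.1 ω.2 t : ℝ) := by
  refine measurable_from_prod_countable_left fun a => ?_
  refine Finset.measurable_sum _ fun t _ => measurable_subtype_coe.comp ?_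
  exact (measurable_pi_apply t).comp (measurable_rewards le_rfl a)

theorem measurable_sum_means (θ : Env K) :
    Measurable fun ω : Outcome K n => ∑ t, mean (θ (ω.2 t)) :=
  (measurable_of_countable fun a : Fin n → Fin K => ∑ t, mean (θ (a t))).comp measurable_snd

theorem integral_sum_rewards (pol : Policy K) (θ : Env K) :
    ∫ ω, ∑ t, (rewards le_rfl ω.1 ω.2 t : ℝ) ∂law pol θ n =
      ∫ ω, ∑ t, mean (θ (ω.2 t)) ∂law pol θ n := by
  rw [integral_law_eq_toReal pol θ measurable_sum_rewards
      fun ω => Finset.sum_nonneg fun t _ => (rewards le_rfl ω.1 ω.2 t).2.1,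
    integral_law_eq_toReal pol θ (measurable_sum_means θ)
      fun ω => Finset.sum_nonneg fun t _ => mean_nonneg _]
  have h := lintegral_sum_rewards pol θ (le_refl n)
  simp_rw [← ENNReal.ofReal_sum_of_nonneg fun t _ => mean_nonneg _] at h
  rw [← h]
  congr 1
  refine lintegral_congr fun x => Finset.sum_congr rfl fun a _ => ?_
  rw [ENNReal.ofReal_sum_of_nonneg fun t _ => (rewards le_rfl x a t).2.1]

theorem integral_sum_row (pol : Policy K) (θ : Env K) (k : Fin K) :
    ∫ ω, ∑ t, (ω.1 k t : ℝ) ∂law pol θ n = n * mean (θ k) := by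
  rw [integral_law_eq_toReal pol θ (by fun_prop)
      fun ω => Finset.sum_nonneg fun t _ => (ω.1 k t).2.1]
  simp_rw [← Finset.sum_mul, sum_prefixProb, one_mul]
  have h : ∀ t : Fin n, ∫⁻ x, ENNReal.ofReal (x k t : ℝ) ∂tableLaw θ n =
      ENNReal.ofReal (mean (θ k)) := by
    intro t
    have := lintegral_tableLaw_mul_entry θ (n := n) (f := fun _ => 1) measurable_const
      (g := fun z => ENNReal.ofReal (z : ℝ)) (by fun_prop) k t fun _ _ _ => rfl
    simpa [← ofReal_mean] using this
  rw [lintegral_congr fun x => ENNReal.ofReal_sum_of_nonneg fun t _ => (x k t).2.1,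
    lintegral_finsetSum _ fun t _ => by fun_prop]
  simp [h, ENNReal.toReal_ofReal (mean_nonneg _)]

/-- If the arm `k` has mean `b + Δ` and the other arms have mean at most `b`, every round at which
another arm is played costs at least `Δ` in expectation. -/
theorem mul_sub_integral_pulls_le_integral_regret (pol : Policy K) (θ : Env K) (k : Fin K)
    {b Δ : ℝ} (hk : mean (θ k) = b + Δ) (hb : ∀ j, j ≠ k → mean (θ j) ≤ b) :
    Δ * (n - ∫ ω, (pulls k ω : ℝ) ∂law pol θ n) ≤ ∫ ω, regret k ω ∂law pol θ n := by
  have hpi := integrable_pulls (n := n) pol θ k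
  have hmi : Integrable (fun ω : Outcome K n => ∑ t, mean (θ (ω.2 t))) (law pol θ n) :=
    integrable_law_of_bound (C := ∑ _ : Fin n, bestMean θ) pol θ (measurable_sum_means θ)
      (fun ω => Finset.sum_nonneg fun t _ => mean_nonneg _)
      (fun ω => Finset.sum_le_sum fun t _ => mean_le_bestMean θ _)
  have hri : Integrable (fun ω : Outcome K n => ∑ t, (rewards le_rfl ω.1 ω.2 t : ℝ))
      (law pol θ n) :=
    integrable_law_of_bound (C := ∑ _ : Fin n, 1) pol θ measurable_sum_rewards
      (fun ω => Finset.sum_nonneg fun t _ => (rewards le_rfl ω.1 ω.2 t).2.1)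
      (fun ω => Finset.sum_le_sum fun t _ => (rewards le_rfl ω.1 ω.2 t).2.2)
  have hxi : Integrable (fun ω : Outcome K n => ∑ t, (ω.1 k t : ℝ)) (law pol θ n) :=
    integrable_law_of_bound (C := ∑ _ : Fin n, 1) pol θ (by fun_prop)
      (fun ω => Finset.sum_nonneg fun t _ => (ω.1 k t).2.1)
      (fun ω => Finset.sum_le_sum fun t _ => (ω.1 k t).2.2)
  have hsum : ∫ ω, ∑ t, mean (θ (ω.2 t)) ∂law pol θ n ≤
      ∫ ω, ((n : ℝ) * b + Δ * (pulls k ω : ℝ)) ∂law pol θ n := by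
    refine integral_mono hmi ((integrable_const _).add (hpi.const_mul Δ)) fun ω => ?_
    have hp : (pulls k ω : ℝ) = ∑ t, if ω.2 t = k then 1 else 0 := by simp [pulls]
    calc ∑ t, mean (θ (ω.2 t)) ≤ ∑ t, (b + Δ * if ω.2 t = k then 1 else 0) := by
          refine Finset.sum_le_sum fun t _ => ?_
          by_cases h : ω.2 t = k
          · simp [h, hk]
          · simpa [h] using hb _ h
      _ = n * b + Δ * (pulls k ω : ℝ) := by
          rw [Finset.sum_add_distrib, ← Finset.mul_sum, hp]; simp
  rw [integral_add (integrable_const _) (hpi.const_mul Δ), integral_const_mul Δ] at hsum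
  simp only [integral_const, probReal_univ, one_smul] at hsum
  unfold regret
  rw [integral_sub hxi hri, integral_sum_rewards, integral_sum_row, hk]
  linarith

/-- Markov's inequality for the nonnegative variable `n - T_k(n)`, which exceeds `n - F` on the
event. -/
theorem sub_mul_law_pulls_lt_le (pol : Policy K) (θ : Env K) (k : Fin K) (F : ℕ) :
    ((n : ℝ) - F) * (law pol θ n).real {ω | pulls k ω < F} ≤
      n - ∫ ω, (pulls k ω : ℝ) ∂law pol θ n := by
  have hpi := integrable_pulls (n := n) pol θ k
  have hle : ∀ ω : Outcome K n, (pulls k ω : ℝ) ≤ n := fun ω => Nat.cast_le.2 (pulls_le k ω)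
  have he : ∫ ω, ((n : ℝ) - (pulls k ω : ℝ)) ∂law pol θ n =
      n - ∫ ω, (pulls k ω : ℝ) ∂law pol θ n := by
    rw [integral_sub (integrable_const _) hpi]; simp
  rw [← he, mul_comm, ← smul_eq_mul, ← integral_indicator_const _ (measurableSet_pulls_lt k F)]
  refine integral_mono ((integrable_const _).indicator (measurableSet_pulls_lt k F))
    ((integrable_const _).sub hpi) fun ω => ?_
  by_cases h : pulls k ω < F
  · have h' : (pulls k ω : ℝ) ≤ F := by exact_mod_cast h.le
    simp only [Set.indicator, Set.mem_ofPred_eq, h, if_true]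
    linarith
  · simpa [Set.indicator, h] using hle ω

end Bandit

/-! ### Asymptotics under consistency. -/

namespace Bandit

variable {K : ℕ}

/-- Under an environment of `Θ` whose unique best arm is `k`, a consistent policy rarely plays the
arm `k` less than `F n` times if `F n ≤ n / 2`. -/
theorem IsConsistent.eventually_law_pulls_lt_le {Θ : Fin K → Set RewardDist} {α : ℝ}
    {pol : ℕ → Policy K} (hpol : IsConsistent Θ α pol) {θ : Env K} (hθ : ∀ j, θ j ∈ Θ j)
    {k : Fin K} {b Δ : ℝ} (hΔ : 0 < Δ) (hk : mean (θ k) = b + Δ)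
    (hb : ∀ j, j ≠ k → mean (θ j) ≤ b) {a : ℝ} (ha : α < a) {F : ℕ → ℕ}
    (hF : ∀ᶠ n in atTop, (F n : ℝ) ≤ n / 2) :
    ∀ᶠ n : ℕ in atTop, (law (pol n) θ n).real {ω | pulls k ω < F n} ≤
      2 / Δ * (n : ℝ) ^ (a - 1) := by
  obtain ⟨kstar, hks, hreg⟩ := hpol θ hθ
  -- Consistency supplies some best arm; the gap `Δ` makes `k` the only candidate.
  obtain rfl : kstar = k := by
    by_contra h
    have h1 := hb _ h
    have h2 := mean_le_bestMean θ k
    linarith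
  filter_upwards [(hreg a ha).bound one_pos, hF, eventually_gt_atTop 0] with n hn hFn hn0
  have hn0' : (0 : ℝ) < n := by exact_mod_cast hn0
  rw [one_mul, Real.norm_of_nonneg (Real.rpow_nonneg hn0'.le a)] at hn
  have h1 := sub_mul_law_pulls_lt_le (n := n) (pol n) θ kstar (F n)
  have h2 := mul_sub_integral_pulls_le_integral_regret (n := n) (pol n) θ kstar hk hb
  have h3 := (le_abs_self _).trans hn
  set p := (law (pol n) θ n).real {ω | pulls kstar ω < F n}
  have hp : 0 ≤ p := measureReal_nonneg
  -- Here `F n ≤ n / 2` gives `n - F n ≥ n / 2`, the source of the constant `2 / Δ`.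
  have h4 : (n : ℝ) / 2 * p ≤ ((n : ℝ) - F n) * p := by
    gcongr; linarith
  have h5 : Δ * ((n : ℝ) / 2 * p) ≤ (n : ℝ) ^ a :=
    (mul_le_mul_of_nonneg_left (h4.trans h1) hΔ.le).trans (h2.trans h3)
  rw [Real.rpow_sub_one hn0'.ne']
  have e : 2 / Δ * ((n : ℝ) ^ a / n) = (n : ℝ) ^ a / (Δ * (n / 2)) := by field_simp
  rw [e, le_div_iff₀ (by positivity)]
  linarith

theorem tendsto_log_natCast_atTop : Tendsto (fun n : ℕ => Real.log n) atTop atTop :=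
  Real.tendsto_log_atTop.comp tendsto_natCast_atTop_atTop

theorem eventually_ceil_mul_log_le (β : ℝ) :
    ∀ᶠ n : ℕ in atTop, ((⌈β * Real.log n⌉₊ : ℕ) : ℝ) ≤ n / 2 := by
  have h1 : (fun n : ℕ => Real.log n) =o[atTop] fun n : ℕ => (n : ℝ) :=
    Real.isLittleO_log_id_atTop.comp_tendsto tendsto_natCast_atTop_atTop
  have h2 := (h1.const_mul_left β).bound (show (0 : ℝ) < 1 / 4 by norm_num)
  filter_upwards [h2, eventually_ge_atTop 4] with n hn hn4
  have hn4' : (4 : ℝ) ≤ n := by exact_mod_cast hn4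
  rw [Real.norm_of_nonneg (Nat.cast_nonneg n)] at hn
  have h3 := (le_abs_self _).trans hn
  have h4 : ((⌈β * Real.log n⌉₊ : ℕ) : ℝ) ≤ ⌈(n : ℝ) / 4⌉₊ := by
    exact_mod_cast Nat.ceil_mono (by linarith)
  have h5 := Nat.ceil_lt_add_one (show (0 : ℝ) ≤ (n : ℝ) / 4 by positivity)
  linarith

/-- If `β` times the divergence from the arm `k` to a distribution that makes it the best arm is
less than `1 - α`, then with high probability the arm `k` is played at least `β log n` times. -/
theorem IsConsistent.tendsto_law_pulls_lt_zero {Θ : Fin K → Set RewardDist} {α : ℝ}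
    {pol : ℕ → Policy K} (hpol : IsConsistent Θ α pol) {θ : Env K} (hθ : ∀ j, θ j ∈ Θ j)
    {k : Fin K} {ν : RewardDist} (hν : ν ∈ Θ k) (hbest : bestMean θ < mean ν)
    (hkl : klDiv (θ k : Measure I) (ν : Measure I) ≠ ∞) {β : ℝ} (hβ : 0 < β)
    (hβα : β * (klDiv (θ k : Measure I) (ν : Measure I)).toReal < 1 - α) :
    Tendsto (fun n : ℕ => law (pol n) θ n {ω | pulls k ω < ⌈β * Real.log n⌉₊}) atTop (𝓝 0) := by
  obtain ⟨hac, hint⟩ := klDiv_ne_top_iff.1 hkl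
  -- The mass correction in `klDiv` vanishes for two probability measures.
  have hmean : ∫ x, llr (θ k : Measure I) (ν : Measure I) x ∂(θ k : Measure I) =
      (klDiv (θ k : Measure I) (ν : Measure I)).toReal :=
    (toReal_klDiv_of_measure_eq hac (by simp)).symm
  set κ := (klDiv (θ k : Measure I) (ν : Measure I)).toReal with hκ
  have hκ0 : 0 ≤ κ := ENNReal.toReal_nonneg
  -- The slope `c` exceeds the mean of the log-likelihood ratio, so the deviation is rare, yet `c *
  -- β < 1 - α` leaves room for an exponent `a > α` with `c * β + a - 1 < 0`.
  obtain ⟨c, hc1, hc2⟩ : ∃ c, κ < c ∧ c < (1 - α) / β :=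
    exists_between (by rw [lt_div_iff₀ hβ]; linarith)
  rw [lt_div_iff₀ hβ] at hc2
  have hc0 : 0 < c := hκ0.trans_lt hc1
  obtain ⟨a, ha1, ha2⟩ : ∃ a, α < a ∧ a < 1 - c * β := exists_between (by linarith)
  set F : ℕ → ℕ := fun n => ⌈β * Real.log n⌉₊ with hF
  have hFt : Tendsto F atTop atTop :=
    tendsto_nat_ceil_atTop.comp (tendsto_log_natCast_atTop.const_mul_atTop hβ)
  have hF2 : ∀ᶠ n in atTop, (F n : ℝ) ≤ n / 2 := eventually_ceil_mul_log_le β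
  have hFn : ∀ᶠ n in atTop, F n ≤ n := hF2.mono fun n hn => by
    have : (F n : ℝ) ≤ n := hn.trans (half_le_self (Nat.cast_nonneg n))
    exact_mod_cast this
  have hdev := tendsto_pi_sum_gt_zero (θ k : Measure I) (measurable_llr _ _) hint
    (hmean.trans_lt hc1) hFt hFn
  set θ' := Function.update θ k ν with hθ'
  have hθ'Θ : ∀ j, θ' j ∈ Θ j := fun j => by
    by_cases hj : j = k
    · subst hj; simpa [hθ'] using hν
    · simpa [hθ', hj] using hθ j
  have hsmall := hpol.eventually_law_pulls_lt_le hθ'Θ (k := k) (b := bestMean θ)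
    (Δ := mean ν - bestMean θ) (by linarith) (by simp [hθ'])
    (fun j hj => by simpa [hθ', hj] using mean_le_bestMean θ j) ha1 hF2
  have hrest : Tendsto (fun n : ℕ => ENNReal.ofReal (Real.exp (F n * c)) *
      law (pol n) θ' n {ω | pulls k ω < F n}) atTop (𝓝 0) := by
    have hlim : Tendsto (fun n : ℕ => ENNReal.ofReal
        (Real.exp c * (2 / (mean ν - bestMean θ)) * (n : ℝ) ^ (-(1 - c * β - a)))) atTop (𝓝 0) := by
      rw [← ENNReal.ofReal_zero]
      refine ENNReal.tendsto_ofReal ?_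
      have := ((tendsto_rpow_neg_atTop (show 0 < 1 - c * β - a by linarith)).comp
        tendsto_natCast_atTop_atTop).const_mul (Real.exp c * (2 / (mean ν - bestMean θ)))
      simpa using this
    refine tendsto_of_tendsto_of_tendsto_of_le_of_le' tendsto_const_nhds hlim
      (Eventually.of_forall fun _ => zero_le) ?_
    filter_upwards [hsmall, eventually_ge_atTop 1] with n hn hn1
    have hn0 : (0 : ℝ) < n := by exact_mod_cast hn1
    have hlog : 0 ≤ Real.log n := Real.log_natCast_nonneg n
    rw [← ofReal_measureReal, ← ENNReal.ofReal_mul (Real.exp_pos _).le]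
    refine ENNReal.ofReal_le_ofReal ?_
    -- Rounding up adds at most one to `β log n`, hence the factor `exp c`.
    have hexp : Real.exp (F n * c) ≤ Real.exp c * (n : ℝ) ^ (c * β) := by
      rw [Real.rpow_def_of_pos hn0, ← Real.exp_add]
      refine Real.exp_le_exp.2 ?_
      have := (Nat.ceil_lt_add_one (mul_nonneg hβ.le hlog)).le
      calc (F n : ℝ) * c ≤ (β * Real.log n + 1) * c := by gcongr
        _ = _ := by ring
    calc Real.exp (F n * c) * (law (pol n) θ' n).real {ω | pulls k ω < F n}
        ≤ (Real.exp c * (n : ℝ) ^ (c * β)) *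
          (2 / (mean ν - bestMean θ) * (n : ℝ) ^ (a - 1)) := by gcongr
      _ = Real.exp c * (2 / (mean ν - bestMean θ)) * (n : ℝ) ^ (-(1 - c * β - a)) := by
          rw [show -(1 - c * β - a) = c * β + (a - 1) by ring, Real.rpow_add hn0]; ring
  refine tendsto_of_tendsto_of_tendsto_of_le_of_le tendsto_const_nhds
    (by simpa using hdev.add hrest) (fun _ => zero_le) fun n => ?_
  exact law_pulls_lt_le (pol n) θ k ν hac (F n) (F n * c)

theorem mul_law_le_integral_pulls {n : ℕ} (pol : Policy K) (θ : Env K) (k : Fin K) (y : ℝ) :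
    y * (law pol θ n).real {ω | y ≤ (pulls k ω : ℝ)} ≤ ∫ ω, (pulls k ω : ℝ) ∂law pol θ n :=
  mul_meas_ge_le_integral_of_nonneg (Eventually.of_forall fun _ => Nat.cast_nonneg _)
    (integrable_pulls pol θ k) y

end Bandit

/-! ### The main theorem. -/

theorem mainTheorem1 {K : ℕ} (Θ : Fin K → Set Bandit.RewardDist)
    (α : ℝ) (hα0 : 0 ≤ α) (hα1 : α ≤ 1)
    (pol : ℕ → Bandit.Policy K) (hpol : Bandit.IsConsistent Θ α pol)
    (θ : Bandit.Env K) (hθ : ∀ k, θ k ∈ Θ k)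
    (k : Fin K) (hk : Bandit.mean (θ k) < Bandit.bestMean θ)
    (hD0 : 0 < Bandit.infKL Θ θ k) (hD : Bandit.infKL Θ θ k < ∞) :
    (∀ ε : ℝ, 0 < ε →
      Tendsto
        (fun n : ℕ => Bandit.law (pol n) θ n
          {ω | (1 - ε) * ((1 - α) * Real.log n / (Bandit.infKL Θ θ k).toReal)
            ≤ (Bandit.pulls k ω : ℝ)})
        atTop (𝓝 1)) ∧
    (((1 - α) / (Bandit.infKL Θ θ k).toReal : ℝ) : EReal) ≤
      liminf
        (fun n : ℕ =>
          (((∫ ω, (Bandit.pulls k ω : ℝ) ∂(Bandit.law (pol n) θ n)) / Real.log n : ℝ) : EReal))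
        atTop := by
  set D := (Bandit.infKL Θ θ k).toReal with hDdef
  have hDpos : 0 < D := ENNReal.toReal_pos hD0.ne' hD.ne
  have hprob : ∀ ε : ℝ, 0 < ε → Tendsto (fun n : ℕ => Bandit.law (pol n) θ n
      {ω | (1 - ε) * ((1 - α) * Real.log n / D) ≤ (Bandit.pulls k ω : ℝ)}) atTop (𝓝 1) := by
    intro ε hε
    have hthr : ∀ n : ℕ, (1 - ε) * ((1 - α) * Real.log n / D) =
        (1 - ε) * (1 - α) / D * Real.log n := fun n => by ring
    simp_rw [hthr]
    -- If `ε ≥ 1` or `α = 1`, the threshold is nonpositive and the event is everything.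
    rcases le_or_gt ((1 - ε) * (1 - α)) 0 with hle | hpos
    · have huniv : ∀ n : ℕ, {ω : Bandit.Outcome K n |
          (1 - ε) * (1 - α) / D * Real.log n ≤ (Bandit.pulls k ω : ℝ)} = Set.univ := by
        intro n
        refine Set.eq_univ_of_forall fun ω => ?_
        rw [Set.mem_ofPred_eq]
        refine le_trans ?_ (Nat.cast_nonneg _)
        exact mul_nonpos_of_nonpos_of_nonneg (div_nonpos_of_nonpos_of_nonneg hle hDpos.le)
          (Real.log_natCast_nonneg n)
      simp [huniv]
    · have hα : 0 < 1 - α := lt_of_le_of_ne (by linarith) fun h => by simp [← h] at hpos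
      have hε1 : 0 < 1 - ε := pos_of_mul_pos_left hpos hα.le
      -- As `0 < 1 - ε < 1`, the value `D / (1 - ε)` exceeds the infimum, so some admissible `ν` has
      -- divergence below it. Then `β = (1 - ε) * (1 - α) / D` satisfies `β * κ < 1 - α`.
      have hlt : Bandit.infKL Θ θ k < ENNReal.ofReal (D / (1 - ε)) := by
        rw [← ENNReal.ofReal_toReal hD.ne]
        refine (ENNReal.ofReal_lt_ofReal_iff (by positivity)).2 ?_
        rw [lt_div_iff₀ hε1]
        nlinarith
      obtain ⟨ν, ⟨hν, hbest⟩, hkl⟩ := by simpa only [Bandit.infKL, iInf_lt_iff, exists_prop] using hlt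
      have hfin := (hkl.trans ENNReal.ofReal_lt_top).ne
      have hkl' := (ENNReal.lt_ofReal_iff_toReal_lt hfin).1 hkl
      have h0 := hpol.tendsto_law_pulls_lt_zero hθ hν hbest hfin
        (β := (1 - ε) * (1 - α) / D) (by positivity) (by
          rw [lt_div_iff₀ hε1] at hkl'
          rw [div_mul_eq_mul_div, div_lt_iff₀ hDpos]
          nlinarith)
      have h1 := ENNReal.Tendsto.sub (tendsto_const_nhds (x := (1 : ℝ≥0∞)) (f := atTop)) h0
        (Or.inl ENNReal.one_ne_top)
      rw [tsub_zero] at h1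
      refine h1.congr fun n => ?_
      -- For an integer count, being below the ceiling is the same as being below the real
      -- threshold.
      rw [← prob_compl_eq_one_sub (Bandit.measurableSet_pulls_lt k _)]
      congr 1
      ext ω
      simp [Nat.lt_ceil]
  refine ⟨hprob, ?_⟩
  have hbound : ∀ ε : ℝ, 0 < ε → (((1 - ε) * ((1 - α) / D) : ℝ) : EReal) ≤
      liminf (fun n : ℕ => (((∫ ω, (Bandit.pulls k ω : ℝ) ∂(Bandit.law (pol n) θ n)) /
        Real.log n : ℝ) : EReal)) atTop := by
    intro ε hε
    have h1 : Tendsto (fun n : ℕ => (1 - ε) * ((1 - α) / D) * (Bandit.law (pol n) θ n).real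
        {ω | (1 - ε) * ((1 - α) * Real.log n / D) ≤ (Bandit.pulls k ω : ℝ)}) atTop
        (𝓝 ((1 - ε) * ((1 - α) / D))) := by
      have := ((ENNReal.tendsto_toReal ENNReal.one_ne_top).comp (hprob ε hε)).const_mul
        ((1 - ε) * ((1 - α) / D))
      simpa [Measure.real] using this
    have h2 := ((continuous_coe_real_ereal.tendsto _).comp h1).liminf_eq
    rw [← h2]
    refine liminf_le_liminf ?_
    filter_upwards [Bandit.tendsto_log_natCast_atTop.eventually_gt_atTop 0] with n hn
    refine EReal.coe_le_coe_iff.2 ?_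
    rw [le_div_iff₀ hn]
    refine le_trans (le_of_eq ?_) (Bandit.mul_law_le_integral_pulls (pol n) θ k
      ((1 - ε) * ((1 - α) * Real.log n / D)))
    ring
  -- The liminf does not depend on `ε`, so `ε` may decrease to `0` in the lower bound.
  have hlim : Tendsto (fun ε : ℝ => (((1 - ε) * ((1 - α) / D) : ℝ) : EReal)) (𝓝[>] 0)
      (𝓝 (((1 - α) / D : ℝ) : EReal)) := by
    refine (continuous_coe_real_ereal.tendsto _).comp ?_
    have : Continuous fun ε : ℝ => (1 - ε) * ((1 - α) / D) := by fun_prop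
    simpa using (this.tendsto 0).mono_left nhdsWithin_le_nhds
  exact le_of_tendsto hlim (eventually_mem_nhdsWithin.mono hbound)
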